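/- Let $R$ be a ring with $1$ and $M$ a (left) $R$-module of finite length. A *virtual constituent* of $M$ is a subquotient $N/L$ ($L\subseteq N\subseteq M$ submodules), taken modulo the equivalence relation generated by the natural identifications $(A+B)/B\sim A/(A\cap B)$ (not modulo isomorphism). We say that $Q$ is a *subconstituent* of $P$ if, for suitable representatives, $Q$ is a submodule of a quotient of $P$. We say that $Q$ is *enclosed* by $P$ if $Q=P$ or $Q$ is obtained from $P$ by finitely many steps, each of which passes from some $N/L$ to $K/L$ or to $N/K$, where $L\subseteq K\subseteq N$ and $K/L$ is not a direct summand of $N/L$. A *virtual diagram* $\mathfrak D$ of $M$ is a finite acyclic oriented graph (edges point downwards) with a submodule $P_x\subseteq M$ for every vertex $x$. For a vertex set $U$ write $M_U=\sum_{x\in U}P_x$; call $U$ *open* if it is closed under going down along edges; let $Q_x$ be the sum of the $P_y$ over all vertices $y$ strictly below $x$. It is required that: every $P_x/Q_x$ is simple (the simple constituent at the vertex $x$); $\sum_xP_x=M$; the number of vertices is the length of $M$; every edge $x\to y$ represents a non-split extension, i.e. $\{x,y\}=U\setminus V$ for some open $V\subseteq U$ such that $M_{V\cup\{y\}}/M_V$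 is not a direct summand of $M_U/M_V$; and fans are not cleaved, i.e. for open $V\subseteq W\subseteq U$, if $M_W/M_V$ is a direct summand of $M_U/M_V$ then $V\cup(U\setminus W)$ is open. Subdiagrams are full subgraphs, identified with their vertex sets; thus the union of two subdiagrams also contains all edges of $\mathfrak D$ joining vertices of the one to vertices of the other. A subdiagram $\mathfrak S$ is *realized* by a virtual constituent $Q$ if $Q$ is represented by some $N/L$, where $L\subseteq N$ are of the form $M_V$, $M_U$ with $V,U$ open, and $\mathfrak S$ consists of exactly those vertices $x$ whose simple constituent occurs in $N/L$, i.e. $P_x=(N\cap P_x)+Q_x$ and $L\cap P_x\subseteq Q_x$. It is *realizable* if some virtual constituent realizes it. Let $\mathfrak D_A,\mathfrak D_B$ be non-empty connected subdiagrams of $\mathfrak D$ realized by virtual constituents $A$ and $B$. Say that they are *joined outside* if there is a monotone path of $\mathfrak D$ with one end in $\mathfrak D_A$ and the other in $\mathfrak D_B$ (in either direction) that passes through a vertex outside $\mathfrak D_A\cup\mathfrak D_B$. 1. If $\mathfrak D_A\cap\mathfrak D_B\neq\emptyset$, then $\mathfrak D_A\cap\mathfrak D_B$ is realized by exactly one virtual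 constituent $K$, and $K$ is the common enclosure $A\wedge B$: it is enclosed by $A$ and by $B$, and every virtual constituent realizing a subdiagram contained in both $\mathfrak D_A$ and $\mathfrak D_B$ is a subconstituent of $K$. 2. Suppose that $\mathfrak D_A$ and $\mathfrak D_B$ are not joined outside and that one of the following holds: (i) $\mathfrak D_A\cap\mathfrak D_B\ne\emptyset$; (ii) $\mathfrak D_A\cup\mathfrak D_B$ contains an edge that lies in neither $\mathfrak D_A$ nor $\mathfrak D_B$; (iii) $A$ and $B$ may be viewed as direct summands of one virtual constituent of $M$. Then $\mathfrak D_A\cup\mathfrak D_B$ is realized by exactly one virtual constituent $C$, the virtual sum $A\widehat{+}B$: $A$ and $B$ are subconstituents of $C$, and $C$ is a subconstituent of every virtual constituent realizing a subdiagram that contains both $\mathfrak D_A$ and $\mathfrak D_B$. In cases (i) and (ii) the subdiagram $\mathfrak D_A\cup\mathfrak D_B$ is connected. 3. If $\mathfrak D_A$ and $\mathfrak D_B$ are joined outside, then $\mathfrak D_A\cup\mathfrak D_B$ is not realizable. -/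

import Mathlib

open Relation

/-! ### Virtual constituents of a module -/

/-- A subquotient `top / bot` of `M`. A submodule of a subquotient (and a quotient of one) is again
given by such a pair, so that `A / B` and `(A / C) / (B / C)`, or a submodule seen inside a larger
submodule, are literally the same pair. -/
structure Subquotient (R M : Type*) [Ring R] [AddCommGroup M] [Module R M] where
  bot : Submodule R M
  top : Submodule R M
  le : bot ≤ top

/-- The natural identification of `(A + B) / B` with `A / (A ∩ B)`. -/
inductive Subquotient.Ident {R M : Type*} [Ring R] [AddCommGroup M] [Module R M] :
    Subquotient R M → Subquotient R M → Prop
  | mk (A B : Submodule R M) : Subquotient.Ident ⟨B, A ⊔ B, le_sup_right⟩ ⟨A ⊓ B, A, inf_le_left⟩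

/-- The virtual constituents of `M`: the objects of its virtual category, i.e. the subquotients of
`M` modulo the equivalence relation generated by the natural identifications (not modulo
isomorphism). -/
def VirtualConstituent (R M : Type*) [Ring R] [AddCommGroup M] [Module R M] :=
  Quot (Subquotient.Ident (R := R) (M := M))

/-- The virtual constituent represented by `N / L`. -/
def VirtualConstituent.of {R M : Type*} [Ring R] [AddCommGroup M] [Module R M]
    (L N : Submodule R M) (h : L ≤ N) : VirtualConstituent R M :=
  Quot.mk _ ⟨L, N, h⟩

/-- For `L ≤ K ≤ N`: the submodule `K / L` is a direct summand of `N / L`. -/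
def SplitsBetween {R M : Type*} [Ring R] [AddCommGroup M] [Module R M]
    (L K N : Submodule R M) : Prop :=
  ∃ C : Submodule R M, K ⊓ C = L ∧ K ⊔ C = N

namespace VirtualConstituent

variable {R M : Type*} [Ring R] [AddCommGroup M] [Module R M]

/-- `Q` is a submodule of a subquotient of `P`. -/
def IsSub (Q P : VirtualConstituent R M) : Prop :=
  ∃ (L L' N' N : Submodule R M) (h₁ : L ≤ L') (h₂ : L' ≤ N') (h₃ : N' ≤ N),
    P = of L N (h₁.trans (h₂.trans h₃)) ∧ Q = of L' N' h₂

/-- `Q` is a submodule or a quotient of `P` in a non-split way. -/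
def NonsplitStep (Q P : VirtualConstituent R M) : Prop :=
  ∃ (L K N : Submodule R M) (h₁ : L ≤ K) (h₂ : K ≤ N),
    ¬ SplitsBetween L K N ∧ P = of L N (h₁.trans h₂) ∧ (Q = of L K h₁ ∨ Q = of K N h₂)

/-- The strict ordering of virtual constituents generated by non-split submodules and quotients. -/
def Slimmer (Q P : VirtualConstituent R M) : Prop :=
  TransGen NonsplitStep Q P

/-- `Q` is enclosed by `P`. -/
def EnclosedBy (Q P : VirtualConstituent R M) : Prop :=
  Q = P ∨ Slimmer Q P

/-- `A` and `B` can both be viewed as direct summands of one virtual constituent `N / L`. -/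
def AreSummandsOfCommon (A B : VirtualConstituent R M) : Prop :=
  ∃ (L N₁ N₂ N : Submodule R M) (h₁ : L ≤ N₁) (h₂ : L ≤ N₂),
    N₁ ≤ N ∧ N₂ ≤ N ∧ SplitsBetween L N₁ N ∧ SplitsBetween L N₂ N ∧ A = of L N₁ h₁ ∧ B = of L N₂ h₂

end VirtualConstituent

/-! ### Virtual diagrams -/

/-- An oriented graph on the vertex set `X` (`edge x y` is an edge going down from `x` to `y`),
together with, for every vertex `x`, the submodule of `M` that belongs to the part of the graph
consisting of `x` and everything below it. -/
structure DiagramData (R M X : Type*) [Ring R] [AddCommGroup M] [Module R M] where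
  edge : X → X → Prop
  span : X → Submodule R M

namespace DiagramData

variable {R M X : Type*} [Ring R] [AddCommGroup M] [Module R M] (D : DiagramData R M X)

/-- There is a downward (monotone) path with at least one edge from `x` to `y`. -/
def Below (y x : X) : Prop := TransGen D.edge x y

/-- The submodule belonging to the vertices strictly below `x`; the simple virtual constituent at
the vertex `x` is `span x / low x`. -/
def low (x : X) : Submodule R M := ⨆ (y : X) (_ : D.Below y x), D.span y

/-- A set of vertices closed under going down. Subdiagrams are full subgraphs and are given by
their vertex sets. -/
def IsOpenSub (U : Set X) : Prop := ∀ x y, x ∈ U → D.edge x y → y ∈ U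

/-- The submodule of `M` that belongs to an open subdiagram. -/
def openSpan (U : Set X) : Submodule R M := ⨆ x ∈ U, D.span x

end DiagramData

/-- A virtual diagram of the module `M`. -/
structure VirtualDiagram (R M X : Type*) [Ring R] [AddCommGroup M] [Module R M] [Fintype X]
    extends DiagramData R M X where
  acyclic : ∀ x, ¬ toDiagramData.Below x x
  /-- Every vertex represents a simple constituent `span x / low x`. -/
  simple_vertex : ∀ x, toDiagramData.low x ⋖ span x
  /-- The whole diagram represents the whole module. -/
  whole : ⨆ x, span x = ⊤
  /-- The vertices account for the composition factors of `M`, each exactly once. -/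
  length_eq : Module.length R M = (Fintype.card X : ℕ∞)
  /-- An edge represents a non-split extension: it is a subdiagram `U \ V`, with `U`, `V` open, and
  in the corresponding subquotient the constituent at the lower end is not a direct summand. -/
  edge_nonsplit : ∀ x y, edge x y → ∃ U V : Set X,
    toDiagramData.IsOpenSub U ∧ toDiagramData.IsOpenSub V ∧ V ⊆ U ∧ U \ V = {x, y} ∧
    ¬ SplitsBetween (toDiagramData.openSpan V) (toDiagramData.openSpan (V ∪ {y}))
      (toDiagramData.openSpan U)
  /-- No cleaving of fans: going up in the subdiagram `U \ V` yields a submodule, going down yields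
  a quotient, but the quotient belonging to `U \ W` is (virtually) also a submodule, equivalently
  the submodule belonging to `W \ V` is also a quotient, only if `U \ W` is open in `U \ V`. -/
  no_cleaving : ∀ V W U : Set X, toDiagramData.IsOpenSub V → toDiagramData.IsOpenSub W →
    toDiagramData.IsOpenSub U → V ⊆ W → W ⊆ U →
    SplitsBetween (toDiagramData.openSpan V) (toDiagramData.openSpan W)
      (toDiagramData.openSpan U) →
    toDiagramData.IsOpenSub (V ∪ (U \ W))

namespace VirtualDiagram

variable {R M X : Type*} [Ring R] [AddCommGroup M] [Module R M] [Fintype X]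
  (D : VirtualDiagram R M X)

/-- The submodules represented by the diagram. -/
def IsVisible (N : Submodule R M) : Prop := ∃ U : Set X, D.IsOpenSub U ∧ N = D.openSpan U

/-- The simple constituent at the vertex `x` occurs in the subquotient `N / L`: the natural map
from `N ∩ span x` to `span x / low x` is onto and kills `L ∩ span x`. -/
def Occurs (x : X) (L N : Submodule R M) : Prop :=
  D.span x ≤ (N ⊓ D.span x) ⊔ D.low x ∧ L ⊓ D.span x ≤ D.low x

/-- The virtual constituent `Q` corresponds to the subdiagram with vertex set `S`: it is `N / L`
for two submodules represented by the diagram, and `S` consists of the vertices occurring in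
`N / L`. -/
def Realizes (S : Set X) (Q : VirtualConstituent R M) : Prop :=
  ∃ (L N : Submodule R M) (h : L ≤ N), D.IsVisible L ∧ D.IsVisible N ∧
    S = {x | D.Occurs x L N} ∧ Q = VirtualConstituent.of L N h

def Realizable (S : Set X) : Prop := ∃ Q, D.Realizes S Q

/-- The subdiagram is non-empty and connected (orientation ignored). -/
def IsConnectedSub (S : Set X) : Prop := ((SimpleGraph.fromRel D.edge).induce S).Connected

/-- The union of the two subdiagrams has an edge lying in neither of them. -/
def HasNewEdge (S T : Set X) : Prop :=
  ∃ x ∈ S ∪ T, ∃ y ∈ S ∪ T, D.edge x y ∧ ¬ (x ∈ S ∧ y ∈ S) ∧ ¬ (x ∈ T ∧ y ∈ T)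

/-- A monotone path through a vertex outside `S ∪ T` has one end in `S` and the other in `T`. -/
def JoinedOutside (S T : Set X) : Prop :=
  ∃ x z y : X, ((x ∈ S ∧ y ∈ T) ∨ (x ∈ T ∧ y ∈ S)) ∧ z ∉ S ∪ T ∧ D.Below z x ∧ D.Below y z

/-- `K` is the common enclosure of `A` and `B`, which realize `S` and `T`: it corresponds to a
subdiagram common to both, is enclosed by both, and contains every constituent that corresponds to
a subdiagram common to both. -/
def IsCommonEnclosure (S T : Set X) (A B K : VirtualConstituent R M) : Prop :=
  (∃ E, E ⊆ S ∧ E ⊆ T ∧ D.Realizes E K) ∧ K.EnclosedBy A ∧ K.EnclosedBy B ∧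
  ∀ (E : Set X) (Q : VirtualConstituent R M), E ⊆ S → E ⊆ T → D.Realizes E Q → Q.IsSub K

/-- `C` is the virtual sum of `A` and `B`, which realize `S` and `T`: it realizes the union of the
two subdiagrams, contains both constituents, and is contained in every constituent that
corresponds to a subdiagram including both. -/
def IsVirtualSum (S T : Set X) (A B C : VirtualConstituent R M) : Prop :=
  D.Realizes (S ∪ T) C ∧ A.IsSub C ∧ B.IsSub C ∧
  ∀ (E : Set X) (Q : VirtualConstituent R M), S ⊆ E → T ⊆ E → D.Realizes E Q → C.IsSub Q

end VirtualDiagram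

open Relation

/-! On open vertex sets, `U ↦ M_U` is an order embedding that turns unions into sums and
intersections into intersections. Sums are immediate; the rest is a length count. Each added vertex
raises the length by at most one, and the vertices number exactly the length of `M`, so no vertex is
redundant (`not_span_le_openSpan_of_below_subset`, `openSpan_inf`).

Hence the simple constituents of `M_U / M_V` sit at `U \ V`, and its virtual constituent depends on
`U \ V` alone. The differences `U \ V` are the path-convex vertex sets, so `S` is realizable iff it
is convex, and then by one virtual constituent only (`realizes_iff`). Inclusion of convex sets gives
subconstituents (`constituent_isSub`).

It remains to handle convex sets: intersections are convex, and a union is convex iff no monotone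
path joins the parts outside. Enclosure comes from `no_cleaving` together with connectedness. -/

theorem Submodule.length_le_add_one_of_wcovBy {R M : Type*} [Ring R] [AddCommGroup M] [Module R M]
    {L N : Submodule R M} (h : L ⩿ N) : Module.length R N ≤ Module.length R L + 1 := by
  rcases h.covBy_or_eq with h | rfl
  · have hs := (covBy_iff_quot_is_simple h.le).mp h
    have h1 : Module.length R (N ⧸ Submodule.comap N.subtype L) = 1 :=
      Module.length_eq_one_iff.mpr hs
    rw [Module.length_eq_add_of_exact (Submodule.inclusion h.le)
      (Submodule.comap N.subtype L).mkQ (Submodule.inclusion_injective h.le)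
      (Submodule.mkQ_surjective _) ?_, h1]
    rw [LinearMap.exact_iff, Submodule.ker_mkQ, Submodule.range_inclusion]
  · exact le_self_add

/-- A set that separates two vertices of a connected subgraph is crossed by an edge. -/
theorem SimpleGraph.exists_adj_of_connected_induce {V : Type*} {G : SimpleGraph V} {S P : Set V}
    (h : (G.induce S).Connected) {a b : V} (ha : a ∈ S) (haP : a ∈ P) (hb : b ∈ S) (hbP : b ∉ P) :
    ∃ x ∈ S, ∃ y ∈ S, x ∈ P ∧ y ∉ P ∧ G.Adj x y := by
  obtain ⟨p⟩ := h.preconnected ⟨a, ha⟩ ⟨b, hb⟩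
  obtain ⟨d, -, hd1, hd2⟩ := p.exists_boundary_dart {v | (v : V) ∈ P} haP hbP
  exact ⟨d.fst, d.fst.2, d.snd, d.snd.2, hd1, hd2, d.adj⟩

/-! ### Open sets, lower closures and convex sets of vertices. -/

namespace DiagramData

variable {R M X : Type*} [Ring R] [AddCommGroup M] [Module R M] {D : DiagramData R M X}

theorem IsOpenSub.of_below {U : Set X} (hU : D.IsOpenSub U) {x y : X} (hx : x ∈ U)
    (h : D.Below y x) : y ∈ U := by
  induction h with
  | single h => exact hU _ _ hx h
  | tail _ h ih => exact hU _ _ ih h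

theorem IsOpenSub.union {U V : Set X} (hU : D.IsOpenSub U) (hV : D.IsOpenSub V) :
    D.IsOpenSub (U ∪ V) := fun x y hx h =>
  hx.imp (fun hx => hU x y hx h) (fun hx => hV x y hx h)

theorem IsOpenSub.inter {U V : Set X} (hU : D.IsOpenSub U) (hV : D.IsOpenSub V) :
    D.IsOpenSub (U ∩ V) := fun x y hx h => ⟨hU x y hx.1 h, hV x y hx.2 h⟩

theorem isOpenSub_setOf_below (x : X) : D.IsOpenSub {y | D.Below y x} :=
  fun _ _ h e => TransGen.tail h e

theorem openSpan_mono {U V : Set X} (h : U ⊆ V) : D.openSpan U ≤ D.openSpan V :=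
  biSup_mono h

theorem span_le_openSpan {U : Set X} {x : X} (h : x ∈ U) : D.span x ≤ D.openSpan U :=
  le_biSup D.span h

theorem openSpan_union (U V : Set X) : D.openSpan (U ∪ V) = D.openSpan U ⊔ D.openSpan V :=
  iSup_union

theorem openSpan_singleton (x : X) : D.openSpan {x} = D.span x := iSup_singleton

theorem low_eq_openSpan (x : X) : D.low x = D.openSpan {y | D.Below y x} := rfl

variable (D) in
/-- The smallest open vertex set containing `S`. -/
def lower (S : Set X) : Set X := {y | ∃ x ∈ S, ReflTransGen D.edge x y}

theorem isOpenSub_lower (S : Set X) : D.IsOpenSub (D.lower S) :=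
  fun _ _ ⟨z, hz, h⟩ e => ⟨z, hz, h.tail e⟩

theorem subset_lower (S : Set X) : S ⊆ D.lower S := fun x hx => ⟨x, hx, .refl⟩

theorem lower_mono {S T : Set X} (h : S ⊆ T) : D.lower S ⊆ D.lower T :=
  fun _ ⟨z, hz, h'⟩ => ⟨z, h hz, h'⟩

theorem lower_subset {S U : Set X} (h : S ⊆ U) (hU : D.IsOpenSub U) : D.lower S ⊆ U := by
  rintro y ⟨x, hx, hxy⟩
  rcases reflTransGen_iff_eq_or_transGen.mp hxy with rfl | hxy
  · exact h hx
  · exact hU.of_below (h hx) hxy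

theorem exists_below_of_mem_lower {S : Set X} {y : X} (hy : y ∈ D.lower S) (hyS : y ∉ S) :
    ∃ x ∈ S, D.Below y x := by
  obtain ⟨x, hx, hxy⟩ := hy
  rcases reflTransGen_iff_eq_or_transGen.mp hxy with rfl | hxy
  · exact absurd hx hyS
  · exact ⟨x, hx, hxy⟩

variable (D) in
/-- Every monotone path between vertices of `S` stays in `S`. -/
def IsConvexSub (S : Set X) : Prop :=
  ∀ x z y, x ∈ S → y ∈ S → D.Below z x → D.Below y z → z ∈ S

theorem IsConvexSub.inter {S T : Set X} (hS : D.IsConvexSub S) (hT : D.IsConvexSub T) :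
    D.IsConvexSub (S ∩ T) := fun x z y hx hy h h' =>
  ⟨hS x z y hx.1 hy.1 h h', hT x z y hx.2 hy.2 h h'⟩

theorem IsOpenSub.isConvexSub_diff {U V : Set X} (hU : D.IsOpenSub U) (hV : D.IsOpenSub V) :
    D.IsConvexSub (U \ V) := fun _ _ _ hx hy h h' =>
  ⟨hU.of_below hx.1 h, fun hz => hy.2 (hV.of_below hz h')⟩

theorem IsConvexSub.isOpenSub_lower_diff {S : Set X} (hS : D.IsConvexSub S) :
    D.IsOpenSub (D.lower S \ S) := by
  rintro x y ⟨hx, hxS⟩ e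
  refine ⟨isOpenSub_lower S x y hx e, fun hy => hxS ?_⟩
  obtain ⟨z, hz, hxz⟩ := exists_below_of_mem_lower hx hxS
  exact hS z x y hz hy hxz (.single e)

theorem lower_diff_lower_diff (S : Set X) : D.lower S \ (D.lower S \ S) = S := by
  rw [Set.sdiff_sdiff_right_self, Set.inter_eq_right.mpr (subset_lower S)]

variable (D) in
/-- The virtual constituent at the vertex set `S`. -/
def constituent (S : Set X) : VirtualConstituent R M :=
  .of (D.openSpan (D.lower S \ S)) (D.openSpan (D.lower S)) (openSpan_mono Set.sdiff_subset)

end DiagramData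

/-! ### Length count and the lattice of the submodules `M_U`. -/

namespace VirtualDiagram

open DiagramData

variable {R M X : Type*} [Ring R] [AddCommGroup M] [Module R M] [Fintype X]
  (D : VirtualDiagram R M X)

theorem openSpan_setOf_below_insert (x : X) :
    D.openSpan ({y | D.Below y x} ∪ {x}) = D.span x := by
  rw [openSpan_union, openSpan_singleton, ← low_eq_openSpan]
  exact sup_eq_right.mpr (D.simple_vertex x).le

theorem isOpenSub_setOf_below_insert (x : X) : D.IsOpenSub ({y | D.Below y x} ∪ {x}) := by
  rintro a b (ha | rfl) e
  · exact .inl (isOpenSub_setOf_below x a b ha e)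
  · exact .inl (.single e)

/-- `M_W ∩ P_x` lies between `Q_x` and `P_x`, which are adjacent; if it is `Q_x`, modularity carries
the covering up to `M_W` and `M_W + P_x`. -/
theorem wcovBy_openSpan_union {W : Set X} {x : X} (hW : {y | D.Below y x} ⊆ W) :
    D.openSpan W ⩿ D.openSpan (W ∪ {x}) := by
  rw [openSpan_union, openSpan_singleton]
  have hlow : D.low x ≤ D.openSpan W := openSpan_mono hW
  by_cases h : D.span x ≤ D.openSpan W
  · rw [sup_eq_left.mpr h]
    exact WCovBy.refl _
  · refine (covBy_sup_of_inf_covBy_right (a := D.openSpan W) (b := D.span x) ?_).wcovBy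
    convert D.simple_vertex x using 1
    refine ((D.simple_vertex x).eq_or_eq (le_inf hlow (D.simple_vertex x).le)
      inf_le_right).resolve_right fun h' => h (inf_eq_right.mp h')

/-- A non-empty difference of vertex sets has a maximal vertex. -/
theorem exists_maximal_diff {U V : Set X} (h : ¬ U ⊆ V) :
    ∃ x ∈ U \ V, ∀ z ∈ U \ V, ¬ D.Below x z := by
  have hwf : WellFounded (fun a b : X => D.Below b a) :=
    @Finite.wellFounded_of_trans_of_irrefl X _ (fun a b => D.Below b a)
      ⟨fun _ _ _ h h' => TransGen.trans h h'⟩ ⟨D.acyclic⟩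
  obtain ⟨x, hx, hmin⟩ := hwf.has_min (U \ V) (Set.sdiff_nonempty.mpr h)
  exact ⟨x, hx, hmin⟩

/-- Induction on open vertex sets containing `V`, adding one vertex at a time. -/
theorem open_induction {V : Set X} (hV : D.IsOpenSub V) {P : Set X → Prop} (base : P V)
    (step : ∀ W x, D.IsOpenSub W → V ⊆ W → x ∉ W → {y | D.Below y x} ⊆ W → P W → P (W ∪ {x}))
    {U : Set X} (hU : D.IsOpenSub U) (hVU : V ⊆ U) : P U := by
  induction hn : U.ncard using Nat.strong_induction_on generalizing U with
  | _ n ih =>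
    by_cases h : U ⊆ V
    · rwa [h.antisymm hVU]
    · obtain ⟨x, ⟨hxU, hxV⟩, hmax⟩ := D.exists_maximal_diff h
      have hUx : U \ {x} ∪ {x} = U := Set.sdiff_union_of_subset (by simpa using hxU)
      have hVx : V ⊆ U \ {x} := fun v hv => ⟨hVU hv, fun hvx => hxV (hvx ▸ hv)⟩
      -- A vertex of `U` with an edge to `x` would lie in `V`, forcing `x ∈ V`, or in `U \ V`,
      -- against maximality.
      have hop : D.IsOpenSub (U \ {x}) := by
        rintro a b ⟨ha, hax⟩ e
        refine ⟨hU a b ha e, ?_⟩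
        rintro rfl
        by_cases haV : a ∈ V
        · exact hxV (hV a _ haV e)
        · exact hmax a ⟨ha, haV⟩ (.single e)
      rw [← hUx]
      refine step _ x hop hVx (by simp) (fun y hy => ⟨hU.of_below hxU hy, ?_⟩)
        (ih _ ?_ hop hVx rfl)
      · rintro rfl
        exact D.acyclic _ hy
      · rw [← hn]
        exact Set.ncard_sdiff_singleton_lt_of_mem hxU

theorem length_openSpan_le {U V : Set X} (hU : D.IsOpenSub U) (hV : D.IsOpenSub V) (h : V ⊆ U) :
    Module.length R (D.openSpan U) + V.ncard ≤ Module.length R (D.openSpan V) + U.ncard := by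
  refine D.open_induction hV (P := fun U => Module.length R (D.openSpan U) + V.ncard ≤
    Module.length R (D.openSpan V) + U.ncard) le_rfl ?_ hU h
  intro W x _ _ hx hW ih
  have h1 := Submodule.length_le_add_one_of_wcovBy (D.wcovBy_openSpan_union hW)
  have h2 : (W ∪ {x}).ncard = W.ncard + 1 := by
    rw [Set.union_singleton, Set.ncard_insert_of_notMem hx]
  calc _ ≤ Module.length R (D.openSpan W) + 1 + V.ncard := by gcongr
    _ = Module.length R (D.openSpan W) + V.ncard + 1 := by ring
    _ ≤ Module.length R (D.openSpan V) + W.ncard + 1 := by gcongr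
    _ = _ := by rw [h2]; push_cast; ring

/-- Otherwise `x` would add no length, and the remaining vertices are too few to reach the length of
`M`. -/
theorem not_span_le_openSpan_of_below_subset {U : Set X} (hU : D.IsOpenSub U) {x : X}
    (hx : x ∉ U) (hxU : {y | D.Below y x} ⊆ U) : ¬ D.span x ≤ D.openSpan U := by
  intro h
  have hop : D.IsOpenSub (U ∪ {x}) := by
    rw [← Set.union_eq_left.mpr hxU, Set.union_assoc]
    exact hU.union (D.isOpenSub_setOf_below_insert x)
  have heq : D.openSpan (U ∪ {x}) = D.openSpan U := by
    rw [openSpan_union, openSpan_singleton, sup_eq_left.mpr h]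
  have h1 := D.length_openSpan_le (U := Set.univ) (fun _ _ _ _ => trivial) hop
    (Set.subset_univ _)
  have h2 := D.length_openSpan_le hU (V := ∅) (fun _ _ h _ => h.elim) (Set.empty_subset _)
  have h3 : D.openSpan Set.univ = ⊤ := by
    rw [← D.whole]
    exact iSup_univ
  have h4 : D.openSpan (∅ : Set X) = ⊥ := iSup_emptyset
  rw [h3, heq, Module.length_top, D.length_eq, Set.ncard_univ, Nat.card_eq_fintype_card,
    Set.union_singleton, Set.ncard_insert_of_notMem hx] at h1
  rw [h4, Module.length_bot, Set.ncard_empty, Nat.cast_zero, add_zero, zero_add] at h2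
  have h5 := h1.trans (add_le_add_left h2 _)
  norm_cast at h5
  omega

theorem openSpan_inf {U V : Set X} (hU : D.IsOpenSub U) (hV : D.IsOpenSub V) :
    D.openSpan U ⊓ D.openSpan V = D.openSpan (U ∩ V) := by
  apply le_antisymm _
    (le_inf (openSpan_mono Set.inter_subset_left) (openSpan_mono Set.inter_subset_right))
  refine D.open_induction (hU.inter hV)
    -- The second disjunct confines the induction to sets inside `U`.
    (P := fun U' => D.openSpan U' ⊓ D.openSpan V ≤ D.openSpan (U ∩ V) ∨ ¬ U' ⊆ U)
    (.inl inf_le_left) ?_ hU Set.inter_subset_left |>.resolve_right (not_not_intro le_rfl)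
  intro W x hWo _ hx hW ih
  by_cases hWU : W ∪ {x} ⊆ U
  · left
    have ih := ih.resolve_right (not_not_intro (Set.subset_union_left.trans hWU))
    have hxV : x ∉ V := fun hxV =>
      hx (‹U ∩ V ⊆ W› ⟨hWU (.inr rfl), hxV⟩)
    refine le_trans (le_inf ?_ inf_le_right) ih
    have hns := D.not_span_le_openSpan_of_below_subset (hWo.union hV) (x := x)
      (by simp [hx, hxV]) (hW.trans Set.subset_union_left)
    -- This intersection is `M_W` or all of `M_{W ∪ {x}}`; the latter would put `P_x` inside `M_{W ∪
    -- V}`.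
    have hle : D.openSpan W ≤ D.openSpan (W ∪ {x}) ⊓ D.openSpan (W ∪ V) :=
      le_inf (openSpan_mono Set.subset_union_left) (openSpan_mono Set.subset_union_left)
    rcases (D.wcovBy_openSpan_union hW).eq_or_eq hle inf_le_left with h | h
    · rw [← h]
      exact inf_le_inf_left _ (openSpan_mono Set.subset_union_right)
    · exact absurd ((span_le_openSpan (.inr rfl)).trans (inf_eq_left.mp h)) hns
  · exact .inr hWU

theorem openSpan_inf_span_le_low {U : Set X} (hU : D.IsOpenSub U) {x : X} (hx : x ∉ U) :
    D.openSpan U ⊓ D.span x ≤ D.low x := by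
  rw [← D.openSpan_setOf_below_insert, D.openSpan_inf hU (D.isOpenSub_setOf_below_insert x),
    low_eq_openSpan]
  refine openSpan_mono ?_
  rintro y ⟨hy, h | rfl⟩
  · exact h
  · exact absurd hy hx

theorem span_le_openSpan_iff {U : Set X} (hU : D.IsOpenSub U) {x : X} :
    D.span x ≤ D.openSpan U ↔ x ∈ U := by
  refine ⟨fun h => ?_, span_le_openSpan⟩
  by_contra hx
  have h1 := D.openSpan_inf_span_le_low hU hx
  rw [inf_eq_right.mpr h] at h1
  exact (D.simple_vertex x).lt.not_ge h1

theorem openSpan_le_iff {U V : Set X} (hU : D.IsOpenSub U) :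
    D.openSpan V ≤ D.openSpan U ↔ V ⊆ U :=
  ⟨fun h _ hx => (D.span_le_openSpan_iff hU).mp ((span_le_openSpan hx).trans h), openSpan_mono⟩

/-! ### Realizable subdiagrams are the convex ones. -/

theorem occurs_openSpan_iff {U V : Set X} (hU : D.IsOpenSub U) (hV : D.IsOpenSub V) {x : X} :
    D.Occurs x (D.openSpan V) (D.openSpan U) ↔ x ∈ U \ V := by
  have hlt := (D.simple_vertex x).lt
  constructor
  · rintro ⟨h1, h2⟩
    constructor
    · by_contra hx
      exact hlt.not_ge (h1.trans (sup_le (D.openSpan_inf_span_le_low hU hx) le_rfl))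
    · intro hx
      rw [inf_eq_right.mpr (span_le_openSpan hx)] at h2
      exact hlt.not_ge h2
  · rintro ⟨h1, h2⟩
    exact ⟨le_sup_of_le_left (le_inf (span_le_openSpan h1) le_rfl),
      D.openSpan_inf_span_le_low hV h2⟩

/-- One natural identification suffices, with the span of the lower closure of `U \ V` as `A` and
`M_V` as `B`. -/
theorem of_openSpan_eq_constituent {U V : Set X} (hU : D.IsOpenSub U) (hV : D.IsOpenSub V)
    (h : V ⊆ U) :
    VirtualConstituent.of (D.openSpan V) (D.openSpan U) (openSpan_mono h) =
      D.constituent (U \ V) := by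
  have hE : U \ V ⊆ D.lower (U \ V) := subset_lower _
  have hlU : D.lower (U \ V) ⊆ U := lower_subset Set.sdiff_subset hU
  have hsup : D.openSpan (D.lower (U \ V)) ⊔ D.openSpan V = D.openSpan U := by
    rw [← openSpan_union]
    congr 1
    refine (Set.union_subset hlU h).antisymm fun x hx => ?_
    by_cases hxV : x ∈ V
    · exact .inr hxV
    · exact .inl (hE ⟨hx, hxV⟩)
  have hinf : D.openSpan (D.lower (U \ V)) ⊓ D.openSpan V =
      D.openSpan (D.lower (U \ V) \ (U \ V)) := by
    rw [D.openSpan_inf (isOpenSub_lower _) hV]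
    congr 1
    ext x
    have := @hlU x
    simp only [Set.mem_inter_iff, Set.mem_sdiff]
    tauto
  have key := Quot.sound
    (Subquotient.Ident.mk (D.openSpan (D.lower (U \ V))) (D.openSpan V))
  simp only [hsup, hinf] at key
  exact key

theorem isConvexSub_and_eq_of_realizes {S : Set X} {Q : VirtualConstituent R M}
    (h : D.Realizes S Q) : D.IsConvexSub S ∧ Q = D.constituent S := by
  obtain ⟨_, _, hle, ⟨V, hV, rfl⟩, ⟨U, hU, rfl⟩, rfl, rfl⟩ := h
  have hS : {x | D.Occurs x (D.openSpan V) (D.openSpan U)} = U \ V :=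
    Set.ext fun x => D.occurs_openSpan_iff hU hV
  rw [hS]
  exact ⟨hU.isConvexSub_diff hV,
    D.of_openSpan_eq_constituent hU hV ((D.openSpan_le_iff hU).mp hle)⟩

theorem realizes_constituent {S : Set X} (hS : D.IsConvexSub S) :
    D.Realizes S (D.constituent S) := by
  refine ⟨_, _, openSpan_mono Set.sdiff_subset, ⟨_, hS.isOpenSub_lower_diff, rfl⟩,
    ⟨_, isOpenSub_lower S, rfl⟩, ?_, rfl⟩
  ext x
  rw [Set.mem_ofPred_eq, D.occurs_openSpan_iff (isOpenSub_lower S) hS.isOpenSub_lower_diff,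
    lower_diff_lower_diff]

theorem realizes_iff {S : Set X} {Q : VirtualConstituent R M} :
    D.Realizes S Q ↔ D.IsConvexSub S ∧ Q = D.constituent S :=
  ⟨D.isConvexSub_and_eq_of_realizes, fun h => h.2 ▸ D.realizes_constituent h.1⟩

theorem lower_diff_union_lower_diff {E F : Set X} (h : E ⊆ F) :
    ((D.lower F \ F) ∪ D.lower E) \ ((D.lower F \ F) ∪ (D.lower E \ E)) = E := by
  ext x
  have := @h x
  have := @subset_lower _ _ _ _ _ _ D.toDiagramData E x
  simp only [Set.mem_union, Set.mem_sdiff]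
  tauto

/-- Adjoining `lower F \ F` to both `lower E` and `lower E \ E` keeps their difference `E` and moves
the pair inside the representative of `F`. -/
theorem constituent_isSub {E F : Set X} (hE : D.IsConvexSub E) (hF : D.IsConvexSub F)
    (h : E ⊆ F) : (D.constituent E).IsSub (D.constituent F) := by
  have hV := hF.isOpenSub_lower_diff
  refine ⟨D.openSpan (D.lower F \ F), D.openSpan ((D.lower F \ F) ∪ (D.lower E \ E)),
    D.openSpan ((D.lower F \ F) ∪ D.lower E), D.openSpan (D.lower F),
    openSpan_mono Set.subset_union_left,
    openSpan_mono (Set.union_subset_union_right _ Set.sdiff_subset),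
    openSpan_mono (Set.union_subset Set.sdiff_subset (lower_mono h)), rfl, ?_⟩
  rw [D.of_openSpan_eq_constituent (hV.union (isOpenSub_lower E))
    (hV.union hE.isOpenSub_lower_diff)
    (Set.union_subset_union_right _ Set.sdiff_subset), D.lower_diff_union_lower_diff h]

/-! ### Enclosure, from uncleaved fans. -/

/-- The lower end of a connected convex subdiagram is cut off by a non-split extension. -/
theorem constituent_lower_inter_enclosedBy {E S : Set X} (hS : D.IsConvexSub S)
    (hconn : D.IsConnectedSub S) (h : E ⊆ S) (hne : E.Nonempty) :
    D.constituent (((D.lower S \ S) ∪ D.lower E) \ (D.lower S \ S)) = D.constituent S ∨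
      (D.constituent (((D.lower S \ S) ∪ D.lower E) \ (D.lower S \ S))).NonsplitStep
        (D.constituent S) := by
  set V := D.lower S \ S with hVdef
  set W := V ∪ D.lower E with hWdef
  have hV : D.IsOpenSub V := hS.isOpenSub_lower_diff
  have hW : D.IsOpenSub W := hV.union (isOpenSub_lower E)
  have hWS : W ⊆ D.lower S := Set.union_subset Set.sdiff_subset (lower_mono h)
  by_cases hSW : D.lower S ⊆ W
  · left
    rw [hWS.antisymm hSW, lower_diff_lower_diff]
  · right
    refine ⟨D.openSpan V, D.openSpan W, D.openSpan (D.lower S),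
      openSpan_mono Set.subset_union_left, openSpan_mono hWS, fun hsplit => ?_, rfl,
      .inl (D.of_openSpan_eq_constituent hW hV Set.subset_union_left).symm⟩
    -- With the complement open as well, no edge in either direction joins `S ∩ W` to `S \ W`,
    -- contradicting connectedness of `S`.
    have hop := D.no_cleaving V W (D.lower S) hV hW (isOpenSub_lower S) Set.subset_union_left
      hWS hsplit
    obtain ⟨e, he⟩ := hne
    obtain ⟨b, hb, hbW⟩ := Set.not_subset.mp hSW
    have hbS : b ∈ S := by
      by_contra hbS
      exact hbW (.inl ⟨hb, hbS⟩)
    obtain ⟨x, hx, y, hy, hxW, hyW, hadj⟩ := SimpleGraph.exists_adj_of_connected_induce hconn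
      (h he) (P := W) (.inr (subset_lower E he)) hbS hbW
    rcases ((SimpleGraph.fromRel_adj _ _ _).mp hadj).2 with hxy | hyx
    · exact hyW (hW x y hxW hxy)
    · rcases hop y x (.inr ⟨subset_lower S hy, hyW⟩) hyx with hxV | hxW'
      · exact hxV.2 hx
      · exact hxW'.2 hxW

/-- The upper end of the part of a convex subdiagram below it is cut off by a non-split
extension. -/
theorem constituent_enclosedBy_lower_inter {E S : Set X} (hS : D.IsConvexSub S)
    (hE : D.IsConvexSub E) (h : E ⊆ S) :
    D.constituent E = D.constituent (((D.lower S \ S) ∪ D.lower E) \ (D.lower S \ S)) ∨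
      (D.constituent E).NonsplitStep
        (D.constituent (((D.lower S \ S) ∪ D.lower E) \ (D.lower S \ S))) := by
  have hdiff := D.lower_diff_union_lower_diff h
  set V := D.lower S \ S with hVdef
  set W := V ∪ D.lower E with hWdef
  set K := V ∪ (D.lower E \ E) with hKdef
  have hV : D.IsOpenSub V := hS.isOpenSub_lower_diff
  have hW : D.IsOpenSub W := hV.union (isOpenSub_lower E)
  have hK : D.IsOpenSub K := hV.union hE.isOpenSub_lower_diff
  have hVK : V ⊆ K := Set.subset_union_left
  have hKW : K ⊆ W := Set.union_subset_union_right _ Set.sdiff_subset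
  by_cases hKV : K ⊆ V
  · left
    rw [hVK.antisymm hKV, hdiff]
  · right
    refine ⟨D.openSpan V, D.openSpan K, D.openSpan W, openSpan_mono hVK, openSpan_mono hKW,
      fun hsplit => ?_, (D.of_openSpan_eq_constituent hW hV (hVK.trans hKW)).symm, .inr ?_⟩
    -- A splitting would make `V ∪ E` open, yet some `w` outside it lies below a vertex of `E`.
    · have hop := D.no_cleaving V K W hV hK hW hVK hKW hsplit
      obtain ⟨w, hwK, hwV⟩ := Set.not_subset.mp hKV
      obtain ⟨hwE, hwE'⟩ := hwK.resolve_left hwV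
      obtain ⟨e, he, hwe⟩ := exists_below_of_mem_lower hwE hwE'
      rw [hdiff] at hop
      exact (hop.of_below (.inr he) hwe).elim hwV hwE'
    · rw [D.of_openSpan_eq_constituent hW hK hKW, hdiff]

/-- The passage from `S` to `E` goes through `S ∩ lower E`: a submodule step, then a quotient step,
either of which may be trivial. Only the submodule step needs connectedness. -/
theorem constituent_enclosedBy {E S : Set X} (hS : D.IsConvexSub S) (hconn : D.IsConnectedSub S)
    (hE : D.IsConvexSub E) (h : E ⊆ S) (hne : E.Nonempty) :
    (D.constituent E).EnclosedBy (D.constituent S) := by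
  rcases D.constituent_enclosedBy_lower_inter hS hE h with h1 | h1 <;>
    rcases D.constituent_lower_inter_enclosedBy hS hconn h hne with h2 | h2
  · exact .inl (h1.trans h2)
  · exact .inr (h1 ▸ .single h2)
  · exact .inr (h2 ▸ .single h1)
  · exact .inr (.tail (.single h1) h2)

/-! ### Unions: convexity and connectedness. -/

/-- Paths with both ends in the same part stay there by convexity, so only paths between the two
parts can leave the union. -/
theorem isConvexSub_union_iff {S T : Set X} (hS : D.IsConvexSub S) (hT : D.IsConvexSub T) :
    D.IsConvexSub (S ∪ T) ↔ ¬ D.JoinedOutside S T := by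
  constructor
  · rintro h ⟨x, z, y, hxy, hz, hzx, hyz⟩
    refine hz (h x z y ?_ ?_ hzx hyz)
    · exact hxy.elim (fun h => .inl h.1) (fun h => .inr h.1)
    · exact hxy.elim (fun h => .inr h.2) (fun h => .inl h.2)
  · intro h x z y hx hy hzx hyz
    by_contra hz
    rcases hx with hx | hx <;> rcases hy with hy | hy
    · exact hz (.inl (hS x z y hx hy hzx hyz))
    · exact h ⟨x, z, y, .inl ⟨hx, hy⟩, hz, hzx, hyz⟩
    · exact h ⟨x, z, y, .inr ⟨hx, hy⟩, hz, hzx, hyz⟩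
    · exact hz (.inr (hT x z y hx hy hzx hyz))

theorem isConnectedSub_union {S T : Set X} (hS : D.IsConnectedSub S) (hT : D.IsConnectedSub T)
    (h : (S ∩ T).Nonempty ∨ D.HasNewEdge S T) : D.IsConnectedSub (S ∪ T) := by
  rcases h with h | ⟨x, hx, y, hy, hxy, hnS, hnT⟩
  · exact SimpleGraph.induce_union_connected hS.preconnected hT.preconnected h
  · have hadj : (SimpleGraph.fromRel D.edge).Adj x y := by
      refine (SimpleGraph.fromRel_adj _ _ _).mpr ⟨?_, .inl hxy⟩
      rintro rfl
      exact D.acyclic x (.single hxy)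
    rcases hx with hx | hx
    · exact SimpleGraph.connected_induce_union hS.preconnected hT.preconnected hx
        (hy.resolve_left fun hy => hnS ⟨hx, hy⟩) hadj
    · exact SimpleGraph.connected_induce_union hS.preconnected hT.preconnected
        (hy.resolve_right fun hy => hnT ⟨hx, hy⟩) hx hadj.symm

end VirtualDiagram

theorem mainTheorem7 {R M X : Type*} [Ring R] [AddCommGroup M] [Module R M]
    [IsArtinian R M] [IsNoetherian R M] [Fintype X] (D : VirtualDiagram R M X)
    (S T : Set X) (A B : VirtualConstituent R M)
    (hS : D.IsConnectedSub S) (hT : D.IsConnectedSub T)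
    (hA : D.Realizes S A) (hB : D.Realizes T B) :
    -- the intersection of overlapping subdiagrams
    ((S ∩ T).Nonempty →
      ∃ K : VirtualConstituent R M, D.Realizes (S ∩ T) K ∧
        (∀ K', D.Realizes (S ∩ T) K' → K' = K) ∧ D.IsCommonEnclosure S T A B K) ∧
    -- the union, when no monotone path outside joins the subdiagrams
    (¬ D.JoinedOutside S T →
      ((S ∩ T).Nonempty ∨ D.HasNewEdge S T ∨ A.AreSummandsOfCommon B) →
      ∃ C : VirtualConstituent R M, D.Realizes (S ∪ T) C ∧
        (∀ C', D.Realizes (S ∪ T) C' → C' = C) ∧ D.IsVirtualSum S T A B C ∧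
        ((S ∩ T).Nonempty ∨ D.HasNewEdge S T → D.IsConnectedSub (S ∪ T))) ∧
    -- the union, when there is such a path
    (D.JoinedOutside S T → ¬ D.Realizable (S ∪ T)) := by
  rw [D.realizes_iff] at hA hB
  obtain ⟨hSc, rfl⟩ := hA
  obtain ⟨hTc, rfl⟩ := hB
  refine ⟨fun hne => ?_, fun hj _ => ?_, fun hj => ?_⟩
  · have hST := hSc.inter hTc
    refine ⟨D.constituent (S ∩ T), D.realizes_constituent hST,
      fun K' hK' => (D.realizes_iff.mp hK').2,
      ⟨S ∩ T, Set.inter_subset_left, Set.inter_subset_right, D.realizes_constituent hST⟩,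
      D.constituent_enclosedBy hSc hS hST Set.inter_subset_left hne,
      D.constituent_enclosedBy hTc hT hST Set.inter_subset_right hne, fun E Q hES hET hQ => ?_⟩
    obtain ⟨hE, rfl⟩ := D.realizes_iff.mp hQ
    exact D.constituent_isSub hE hST (Set.subset_inter hES hET)
  · have hST := (D.isConvexSub_union_iff hSc hTc).mpr hj
    refine ⟨D.constituent (S ∪ T), D.realizes_constituent hST,
      fun C' hC' => (D.realizes_iff.mp hC').2,
      ⟨D.realizes_constituent hST, D.constituent_isSub hSc hST Set.subset_union_left,
        D.constituent_isSub hTc hST Set.subset_union_right, fun E Q hSE hTE hQ => ?_⟩,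
      D.isConnectedSub_union hS hT⟩
    obtain ⟨hE, rfl⟩ := D.realizes_iff.mp hQ
    exact D.constituent_isSub hST hE (Set.union_subset hSE hTE)
  · rintro ⟨Q, hQ⟩
    exact (D.isConvexSub_union_iff hSc hTc).mp (D.realizes_iff.mp hQ).1 hj
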